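/- Theorem. Let $F$ be a field, let $V$ be a finite-dimensional vector space over $F$, and let $b$ be a symplectic form on $V$, i.e. a non-degenerate bilinear form with $b(x,x)=0$ for all $x \in V$. Call an endomorphism $v$ of $V$ $b$-alternating if $b(x,v(x))=0$ for all $x\in V$, and square-zero if $v^2=0$. Call a polynomial $p \in F[t]$ even if $p\in F[t^2]$, and odd if $p \in t\,F[t^2]$. The invariant factors of an endomorphism $u$ of $V$ are the nonconstant monic polynomials $p_1,\dots,p_r \in F[t]$ such that $p_{i+1}$ divides $p_i$ for all $1 \le i<r$ and such that $V$, viewed as an $F[t]$-module through $p(t).x=p(u)(x)$, is isomorphic to $F[t]/(p_1)\oplus\cdots\oplus F[t]/(p_r)$. Let $u$ be a $b$-alternating endomorphism of $V$. The following conditions are equivalent: (i) $u$ is the sum of two square-zero $b$-alternating endomorphisms of $V$; (ii) $u$ is the sum of two square-zero endomorphisms of $V$; (iii) every invariant factor of $u$ is even or odd. Moreover, if the characteristic of $F$ is not $2$, then these conditions are equivalent to each one of the following conditions: (iv) $u$ is similar to $-u$, i.e. $\varphi u \varphi^{-1}=-u$ for some linear automorphism $\varphi$ of $V$; (v) $u$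 is conjugated to $-u$ through an element of the symplectic group of $b$, i.e. $\varphi u \varphi^{-1}=-u$ for some linear automorphism $\varphi$ of $V$ such that $b(\varphi(x),\varphi(y))=b(x,y)$ for all $x,y\in V$. -/

import Mathlib

open scoped DirectSum

/-- The endomorphism `u` is `b`-alternating: `b(x, u(x)) = 0` for all `x`. -/
def IsBAlternating {F V : Type*} [Field F] [AddCommGroup V] [Module F V]
    (b : LinearMap.BilinForm F V) (u : Module.End F V) : Prop :=
  ∀ x : V, b x (u x) = 0

/-- The polynomial `p` is even: `p` belongs to `F[t²]`. -/
def IsEvenPoly {F : Type*} [Field F] (p : Polynomial F) : Prop :=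
  ∃ q : Polynomial F, p = q.comp (Polynomial.X ^ 2)

/-- The polynomial `p` is odd: `p` belongs to `t F[t²]`. -/
def IsOddPoly {F : Type*} [Field F] (p : Polynomial F) : Prop :=
  ∃ q : Polynomial F, p = Polynomial.X * q.comp (Polynomial.X ^ 2)

/-- `p₀, …, p_{r-1}` is the list of invariant factors of `u`: these are nonconstant monic
polynomials, each one is divisible by the following ones, and the `F[t]`-module defined by `u`
(that is, `V` with `p(t) • x = p(u)(x)`) is the direct sum of cyclic modules isomorphic to
`F[t]/(p₀), …, F[t]/(p_{r-1})`. -/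
structure IsInvariantFactorList {F V : Type*} [Field F] [AddCommGroup V] [Module F V]
    (u : Module.End F V) {r : ℕ} (p : Fin r → Polynomial F) : Prop where
  monic : ∀ i, (p i).Monic
  nonconstant : ∀ i, 0 < (p i).natDegree
  dvd : ∀ i j, i ≤ j → p j ∣ p i
  equiv : Nonempty (Module.AEval' u ≃ₗ[Polynomial F]
    (⨁ i : Fin r, (Polynomial F ⧸ Ideal.span {p i})))

/-- `q` is one of the invariant factors of `u`. -/
def IsInvariantFactor {F V : Type*} [Field F] [AddCommGroup V] [Module F V]
    (u : Module.End F V) (q : Polynomial F) : Prop :=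
  ∃ (r : ℕ) (p : Fin r → Polynomial F), IsInvariantFactorList u p ∧ ∃ i, p i = q

/-- Two endomorphisms `u` and `v` are similar: `φ ∘ u ∘ φ⁻¹ = v` for some automorphism `φ`
of the vector space. -/
def AreSimilar {F V : Type*} [Field F] [AddCommGroup V] [Module F V]
    (u v : Module.End F V) : Prop :=
  ∃ φ : V ≃ₗ[F] V, φ.conj u = v

/-- The group of all automorphisms of `V` that preserve `b` (the symplectic group of `b` when
`b` is a symplectic form). -/
def isometryGroup {F V : Type*} [Field F] [AddCommGroup V] [Module F V]
    (b : LinearMap.BilinForm F V) : Subgroup (V ≃ₗ[F] V) where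
  carrier := {φ | ∀ x y : V, b (φ x) (φ y) = b x y}
  mul_mem' {φ ψ} hφ hψ x y := (hφ (ψ x) (ψ y)).trans (hψ x y)
  one_mem' _ _ := rfl
  inv_mem' {φ} hφ x y := by
    have h := hφ (φ.symm x) (φ.symm y)
    simp only [LinearEquiv.apply_symm_apply] at h
    exact h.symm

/-!
The condition on the invariant factors is reached from a sum of two square-zero operators, and from
a similarity with `-u`, by one comparison argument. If `u = a + b` with `a ^ 2 = b ^ 2 = 0`, then
`a * b * u = u * b * a` and `b * a * u = u * a * b`, so that `a * b` and `b * a` behave, up to the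
factor `u ^ 2`, like the projections of a `ℤ/2`-grading for which `u` is odd. After adjoining `ω`
with `ω ^ 2 = 1`, the map `a * b + ω * b * a` is thus semilinear along `X ↦ ω * X`, just as a
similarity from `u` to `-u` is semilinear along `X ↦ -X`. A determinant argument
(`mul_pow_eq_zero_of_semilinear`), which is a form of the uniqueness of invariant factors, shows
that `p` divides the image of `p` under this substitution, up to a power of `X`, for each invariant
factor `p`. With `ω` this means that `p` divides its even and odd parts up to a power of `X`, in any
characteristic; with the sign it is the same statement when `2` is invertible. A comparison of
degrees then shows that `p` is one of these two parts.

Conversely, a vector `x` whose order is the minimal polynomial generates an isotropic cyclic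
submodule, because `b(x, u ^ k x) = 0` for all `k`. It is completed to a hyperbolic pair by
means of the perfect pairing on `F[X] ⧸ (p)` given by the top coefficient modulo `p`, and the span
of the pair splits off orthogonally. By induction `V = L ⊕ L'` with `L`, `L'` Lagrangian, stable
under `u` and with the same invariant factors, those of `u` being each of these repeated twice
(`exists_lagrangian_decomposition`). If all of them are even or odd, then `L` has a `ℤ/2`-grading
for which `u` is odd. The space `L'` is dual to `L`; giving it the dual grading with exchanged
components, one gets a grading of `V` by Lagrangian subspaces which `u` exchanges
(`exists_lagrangian_projections`). If `π` is the projection onto one of them, then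
`u = u * π + u * (1 - π)` is the required sum. If `τ` is the projection onto `L` along `L'`, then the
involutions `2π - 1` and `2τ - 1` both change the sign of the form; the first one anticommutes with
`u` and the second one commutes with it, so their product is an isometry conjugating `u` to `-u`.
-/

open Polynomial

/-! ### Even and odd parts of a polynomial -/

section Parity

variable {F : Type*} [Field F]

/-- The even part of a polynomial: the sum of its monomials of even degree. -/
noncomputable def evenPart : F[X] →ₗ[F] F[X] where
  toFun f := expand F 2 (contract 2 f)
  map_add' f g := by rw [contract_add two_ne_zero, map_add]
  map_smul' c f := by
    ext n
    simp only [coeff_expand two_pos, coeff_contract two_ne_zero, coeff_smul, RingHom.id_apply]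
    split_ifs <;> simp

lemma coeff_evenPart (f : F[X]) (n : ℕ) :
    (evenPart f).coeff n = if 2 ∣ n then f.coeff n else 0 := by
  change (expand F 2 (contract 2 f)).coeff n = _
  rw [coeff_expand two_pos]
  split_ifs with h
  · rw [coeff_contract two_ne_zero, Nat.div_mul_cancel h]
  · rfl

lemma evenPart_evenPart (f : F[X]) : evenPart (evenPart f) = evenPart f := by
  ext n
  simp only [coeff_evenPart]
  split_ifs <;> rfl

lemma evenPart_one : evenPart (1 : F[X]) = 1 := by
  ext n
  rw [coeff_evenPart, coeff_one]
  split_ifs with h1 h2 <;> simp_all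

lemma evenPart_X_mul (f : F[X]) : evenPart (X * f) = X * (f - evenPart f) := by
  ext n
  cases n with
  | zero => simp [coeff_evenPart]
  | succ n =>
    simp only [coeff_evenPart, coeff_X_mul, coeff_sub]
    by_cases h : 2 ∣ n
    · have : ¬ 2 ∣ n + 1 := by lia
      simp [h, this]
    · have : 2 ∣ n + 1 := by lia
      simp [h, this]

lemma evenPart_comp_mul (q f : F[X]) :
    evenPart (q.comp (X ^ 2) * f) = q.comp (X ^ 2) * evenPart f := by
  induction q using Polynomial.induction_on' generalizing f with
  | add p q hp hq => rw [add_comp, add_mul, map_add, hp, hq, add_mul]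
  | monomial n a =>
    have key : ∀ (n : ℕ) (g : F[X]), evenPart ((X ^ 2) ^ n * g) = (X ^ 2) ^ n * evenPart g := by
      intro n
      induction n with
      | zero => simp
      | succ n ih =>
        intro g
        rw [pow_succ, mul_assoc, ih, mul_assoc, sq, mul_assoc, evenPart_X_mul, evenPart_X_mul]
        ring
    rw [monomial_comp, mul_assoc, mul_assoc, ← smul_eq_C_mul, ← smul_eq_C_mul, map_smul, key]

lemma isEvenPoly_evenPart (f : F[X]) : IsEvenPoly (evenPart f) :=
  ⟨contract 2 f, expand_eq_comp_X_pow 2⟩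

lemma isOddPoly_sub_evenPart (f : F[X]) : IsOddPoly (f - evenPart f) := by
  refine ⟨contract 2 f.divX, ?_⟩
  have h : f - evenPart f = X * evenPart f.divX := by
    conv_lhs => rw [← X_mul_divX_add f, map_add, evenPart_X_mul]
    have : evenPart (C (f.coeff 0)) = C (f.coeff 0) := by
      ext n
      rw [coeff_evenPart, coeff_C]
      split_ifs with h1 h2 <;> simp_all
    rw [this]
    ring
  rw [h]
  exact congrArg (X * ·) (expand_eq_comp_X_pow 2)

/-- The even part operator preserves the multiples of an even or odd polynomial. -/
lemma dvd_evenPart_of_dvd {p f : F[X]} (hp : IsEvenPoly p ∨ IsOddPoly p) (h : p ∣ f) :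
    p ∣ evenPart f := by
  obtain ⟨g, rfl⟩ := h
  rcases hp with ⟨q, rfl⟩ | ⟨q, rfl⟩
  · rw [evenPart_comp_mul]
    exact dvd_mul_right _ _
  · rw [mul_assoc, evenPart_X_mul, evenPart_comp_mul, ← mul_sub, ← mul_assoc]
    exact dvd_mul_right _ _

/-- By comparison of degrees, a polynomial dividing its own even and odd parts is one of them. -/
lemma isEvenPoly_or_isOddPoly_of_dvd {p : F[X]} (h0 : p ∣ evenPart p) (h1 : p ∣ p - evenPart p) :
    IsEvenPoly p ∨ IsOddPoly p := by
  have small : ∀ g : F[X], p ∣ g → (∀ n, p.coeff n = 0 → g.coeff n = 0) →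
      g.coeff p.natDegree = 0 → g = 0 := by
    intro g hpg hg hd
    by_contra hne
    have h2 : g.natDegree ≤ p.natDegree := natDegree_le_iff_coeff_eq_zero.2 fun n hn =>
      hg n (coeff_eq_zero_of_natDegree_lt hn)
    have h3 := h2.antisymm (natDegree_le_of_dvd hpg hne)
    rw [← h3, coeff_natDegree, leadingCoeff_eq_zero] at hd
    exact hne hd
  by_cases hd : 2 ∣ p.natDegree
  · left
    have := small _ h1 (fun n hn => by simp [coeff_evenPart, hn]) (by simp [coeff_evenPart, hd])
    rw [sub_eq_zero.1 this]
    exact isEvenPoly_evenPart p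
  · right
    have := small _ h0 (fun n hn => by simp [coeff_evenPart, hn]) (by simp [coeff_evenPart, hd])
    have h := isOddPoly_sub_evenPart p
    rwa [this, sub_zero] at h

/-- A power of `X` on the right of `p ∣ X ^ n * g` is harmless when every monomial of `g`
is a monomial of `p`. -/
lemma dvd_of_dvd_X_pow_mul {p g : F[X]} (hp : p ≠ 0) (hg : ∀ n, p.coeff n = 0 → g.coeff n = 0)
    {n : ℕ} (h : p ∣ X ^ n * g) : p ∣ g := by
  obtain ⟨q, hq, hX⟩ := exists_eq_pow_rootMultiplicity_mul_and_not_dvd p hp 0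
  rw [C_0, sub_zero] at hq hX
  set k := rootMultiplicity 0 p
  have hk : X ^ k ∣ g := X_pow_dvd_iff.2 fun d hd =>
    hg d (X_pow_dvd_iff.1 ⟨q, hq⟩ d hd)
  obtain ⟨g', rfl⟩ := hk
  rw [hq, mul_left_comm] at h
  have h1 := (mul_dvd_mul_iff_left (pow_ne_zero k (X_ne_zero (R := F)))).1 h
  have hco : IsCoprime q (X ^ n) :=
    ((irreducible_X (R := F)).coprime_iff_not_dvd.2 hX).symm.pow_right
  rw [hq]
  exact mul_dvd_mul_left _ (hco.dvd_of_dvd_mul_left h1)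

lemma isEvenPoly_or_isOddPoly_of_dvd_X_pow_mul {p : F[X]} (hp : p ≠ 0) {n : ℕ}
    (h0 : p ∣ X ^ n * evenPart p) (h1 : p ∣ X ^ n * (p - evenPart p)) :
    IsEvenPoly p ∨ IsOddPoly p :=
  isEvenPoly_or_isOddPoly_of_dvd
    (dvd_of_dvd_X_pow_mul hp (fun n hn => by simp [coeff_evenPart, hn]) h0)
    (dvd_of_dvd_X_pow_mul hp (fun n hn => by simp [coeff_evenPart, hn]) h1)

end Parity

/-! ### Comparison of invariant factors through semilinear maps -/

section Comparison

/-- If `c` times each coordinate vector of `B ^ (i + 1)` is a combination of vectors `y l`, and all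
but the first `i` of these are killed by `d`, then `d * c ^ (i + 1) = 0`: modulo the annihilator
of `d`, the scalar matrix `c` of size `i + 1` factors through `B ^ i`. -/
lemma mul_pow_eq_zero_of_smul_single_mem_span {B : Type*} [CommRing B] {r : ℕ} (i : Fin r)
    (c d : B) (y : Fin r → Fin (i + 1) → B) (hd : ∀ l, i ≤ l → d • y l = 0)
    (hc : ∀ m, c • Pi.single m (1 : B) ∈ Submodule.span B (Set.range y)) :
    d * c ^ (i + 1 : ℕ) = 0 := by
  classical
  simp only [Submodule.mem_span_range_iff_exists_fun] at hc
  choose Z hZ using hc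
  let J : Ideal B := (Ideal.span {d}).annihilator
  have hJ : ∀ x, x ∈ J ↔ x * d = 0 := fun x => Submodule.mem_annihilator_span_singleton d x
  let e : Fin (i + 1) → Fin r := Fin.castLE i.2
  have hy : ∀ l, i ≤ l → ∀ m, Ideal.Quotient.mk J (y l m) = 0 := fun l hl m => by
    rw [Ideal.Quotient.eq_zero_iff_mem, hJ, mul_comm]
    exact congrFun (hd l hl) m
  let P : Matrix (Fin (i + 1)) (Fin (i + 1)) (B ⧸ J) :=
    .of fun m l => Ideal.Quotient.mk J (Z m (e l))
  let Q : Matrix (Fin (i + 1)) (Fin (i + 1)) (B ⧸ J) :=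
    .of fun l m => Ideal.Quotient.mk J (y (e l) m)
  have hPQ : P * Q = Matrix.scalar _ (Ideal.Quotient.mk J c) := by
    ext m m'
    have h1 := congrArg (Ideal.Quotient.mk J) (congrFun (hZ m) m')
    simp only [Finset.sum_apply, Pi.smul_apply, smul_eq_mul, map_sum, map_mul] at h1
    rw [Matrix.mul_apply, Matrix.scalar_apply]
    refine (Fintype.sum_of_injective e (Fin.castLE_injective _) _ _ (fun l hl => ?_)
      (fun l => rfl)).trans (h1.trans ?_)
    · have hil : i ≤ l := by
        by_contra hlt
        exact hl ⟨⟨l, by have := Fin.lt_def.1 (not_le.1 hlt); omega⟩, rfl⟩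
      rw [hy l hil, mul_zero]
    · rw [Matrix.diagonal_apply, Pi.single_apply]
      by_cases h : m = m'
      · simp [h]
      · simp [h, Ne.symm h]
  have hQ : Q.det = 0 := Matrix.det_eq_zero_of_row_eq_zero (Fin.last _) fun m => hy _ le_rfl m
  have h := congrArg Matrix.det hPQ
  rw [Matrix.det_mul, hQ, mul_zero, Matrix.scalar_apply, Matrix.det_diagonal, Finset.prod_const,
    Finset.card_univ, Fintype.card_fin, ← map_pow] at h
  rw [mul_comm]
  exact (hJ _).1 (Ideal.Quotient.eq_zero_iff_mem.1 h.symm)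

variable {F : Type*} [Field F]

/-- To prove a property of all polynomials that is stable under linear combinations, it suffices
to check `1` and stability under multiplication by `X`. -/
lemma polynomial_induction {P : F[X] → Prop} (one : P 1) (add : ∀ f g, P f → P g → P (f + g))
    (smul : ∀ (c : F) f, P f → P (c • f)) (X_mul : ∀ f, P f → P (X * f)) (f : F[X]) : P f := by
  induction f using Polynomial.induction_on' with
  | add f g hf hg => exact add f g hf hg
  | monomial n a =>
    rw [← mul_one a, ← smul_eq_mul, ← smul_monomial]
    refine smul a _ ?_
    rw [monomial_one_right_eq_X_pow]
    induction n with
    | zero => simpa using one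
    | succ n ih => rw [pow_succ']; exact X_mul _ ih

variable {M : Type*} [AddCommGroup M] [Module F[X] M] {r : ℕ} {p : Fin r → F[X]}

/-- Let `M` be the direct sum of the modules `F[X] ⧸ (p j)`, with `p j ∣ p i` for `i ≤ j`, and let
`S : M → B ^ (i + 1)` be semilinear along `σ : F[X] → B`. If the `B`-span of the image of `S`
contains `c • B ^ (i + 1)`, then `σ (p i) * c ^ (i + 1) = 0`. -/
lemma mul_pow_eq_zero_of_semilinear (hp : ∀ i j, i ≤ j → p j ∣ p i)
    (E : M ≃ₗ[F[X]] ⨁ j, F[X] ⧸ Ideal.span {p j}) (i : Fin r) {B : Type*} [CommRing B]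
    (σ : F[X] → B) (c : B) (S : M →+ (Fin (i + 1) → B))
    (hS : ∀ (f : F[X]) x, S (f • x) = σ f • S x)
    (hc : ∀ m, c • Pi.single m (1 : B) ∈ Submodule.span B (Set.range S)) :
    σ (p i) * c ^ (i + 1 : ℕ) = 0 := by
  classical
  let e : Fin r → M := fun l =>
    E.symm (DirectSum.lof F[X] _ (fun j => F[X] ⧸ Ideal.span {p j}) l (Ideal.Quotient.mk _ 1))
  refine mul_pow_eq_zero_of_smul_single_mem_span i c (σ (p i)) (fun l => S (e l)) ?_ fun m =>
    Submodule.span_le.2 ?_ (hc m)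
  · intro l hl
    rw [← hS]
    have : p i • e l = 0 := by
      rw [← map_smul, ← map_smul, ← Ideal.Quotient.mk_eq_mk, ← Submodule.Quotient.mk_smul,
        smul_eq_mul, mul_one, Ideal.Quotient.mk_eq_mk,
        Ideal.Quotient.eq_zero_iff_mem.2 (Ideal.mem_span_singleton.2 (hp i l hl)), map_zero,
        map_zero]
    rw [this, map_zero]
  · rintro _ ⟨x, rfl⟩
    choose f hf using fun l => Ideal.Quotient.mk_surjective (E x l)
    have hx : x = ∑ l, f l • e l := by
      apply E.injective
      rw [map_sum]
      simp only [map_smul, e, LinearEquiv.apply_symm_apply]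
      rw [← DirectSum.sum_univ_of (E x)]
      refine Finset.sum_congr rfl fun l _ => ?_
      rw [← map_smul, ← DirectSum.lof_eq_of F[X]]
      congr 1
      rw [← hf l, ← Ideal.Quotient.mk_eq_mk, ← Ideal.Quotient.mk_eq_mk,
        ← Submodule.Quotient.mk_smul, smul_eq_mul, mul_one]
    rw [hx, map_sum]
    refine Submodule.sum_mem _ fun l _ => ?_
    rw [hS]
    exact Submodule.smul_mem _ _ (Submodule.subset_span ⟨l, rfl⟩)

/-- The first `i + 1` coordinates of `⨁ j, F[X] ⧸ (p j)`, reduced modulo `p i`. -/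
noncomputable def reducedCoord (hp : ∀ i j, i ≤ j → p j ∣ p i)
    (E : M ≃ₗ[F[X]] ⨁ j, F[X] ⧸ Ideal.span {p j}) (i : Fin r) (m : Fin (i + 1)) :
    M →ₗ[F[X]] F[X] ⧸ Ideal.span {p i} :=
  (Ideal.Quotient.factorₐ F[X] (Ideal.span_singleton_le_span_singleton.2
      (hp (Fin.castLE i.2 m) i (Nat.lt_succ_iff.1 m.2)))).toLinearMap ∘ₗ
    DirectSum.component F[X] _ (fun j => F[X] ⧸ Ideal.span {p j}) (Fin.castLE i.2 m) ∘ₗ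
      E.toLinearMap

lemma exists_reducedCoord_eq (hp : ∀ i j, i ≤ j → p j ∣ p i)
    (E : M ≃ₗ[F[X]] ⨁ j, F[X] ⧸ Ideal.span {p j}) (i : Fin r) (m : Fin (i + 1)) :
    ∃ x, ∀ m', reducedCoord hp E i m' x =
      (Pi.single m 1 : Fin (i + 1) → F[X] ⧸ Ideal.span {p i}) m' := by
  classical
  refine ⟨E.symm (DirectSum.lof F[X] _ (fun j => F[X] ⧸ Ideal.span {p j}) (Fin.castLE i.2 m) 1),
    fun m' => ?_⟩
  simp only [reducedCoord, LinearMap.comp_apply, LinearEquiv.coe_coe,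
    LinearEquiv.apply_symm_apply, AlgHom.toLinearMap_apply]
  by_cases h : m' = m
  · subst h
    rw [DirectSum.component.lof_self, map_one, Pi.single_eq_same]
  · rw [DirectSum.component.of, dif_neg (fun h' => h (Fin.castLE_injective _ h'.symm)), map_zero,
      Pi.single_eq_of_ne h]

variable [Module F M] [IsScalarTower F F[X] M]

/-- If `X` acts as the sum of two square-zero operators `a` and `b`, then `a * b` and `b * a` play
the role of the two projections of a grading for which `X` is odd, up to the factor `X ^ 2`. -/
lemma mul_smul_of_sq_eq_zero {a b : Module.End F M} (ha : a ^ 2 = 0) (hb : b ^ 2 = 0)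
    (hab : ∀ x, (X : F[X]) • x = a x + b x) (f : F[X]) (x : M) :
    a (b (f • x)) = evenPart f • a (b x) + (f - evenPart f) • b (a x) ∧
      b (a (f • x)) = evenPart f • b (a x) + (f - evenPart f) • a (b x) := by
  have ha' : ∀ x, a (a x) = 0 := fun x => by
    simpa [sq] using LinearMap.congr_fun ha x
  have hb' : ∀ x, b (b x) = 0 := fun x => by
    simpa [sq] using LinearMap.congr_fun hb x
  have hX1 : ∀ x, a (b ((X : F[X]) • x)) = (X : F[X]) • b (a x) := fun x => by
    simp [hab, hb']
  have hX2 : ∀ x, b (a ((X : F[X]) • x)) = (X : F[X]) • a (b x) := fun x => by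
    simp [hab, ha']
  induction f using polynomial_induction with
  | one =>
    simp [evenPart_one]
  | add f g hf hg =>
    simp only [add_smul, sub_smul, map_add, hf.1, hg.1, hf.2, hg.2]
    constructor <;> abel
  | smul c f hf =>
    simp only [smul_assoc, map_smul, hf.1, hf.2, sub_smul, smul_add, smul_sub, and_self]
  | X_mul f hf =>
    have h : X * f - evenPart (X * f) = X * evenPart f := by rw [evenPart_X_mul]; ring
    rw [h, evenPart_X_mul, mul_smul, hX1, hX2, hf.1, hf.2]
    simp only [smul_add, mul_smul]
    exact ⟨add_comm _ _, add_comm _ _⟩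

lemma quadraticAlgebra_mk_mul_mk {Q : Type*} [CommRing Q] (x y z w : Q) :
    (⟨x, y⟩ * ⟨z, w⟩ : QuadraticAlgebra Q 1 0) = ⟨x * z + y * w, x * w + y * z⟩ := by
  ext
  · rw [QuadraticAlgebra.re_mul]; ring
  · rw [QuadraticAlgebra.im_mul]; ring

lemma quadraticAlgebra_mk_zero_pow {Q : Type*} [CommRing Q] (x : Q) (n : ℕ) :
    (⟨x, 0⟩ : QuadraticAlgebra Q 1 0) ^ n = ⟨x ^ n, 0⟩ := by
  induction n with
  | zero => rw [pow_zero, pow_zero]; rfl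
  | succ n ih => rw [pow_succ, ih, quadraticAlgebra_mk_mul_mk]; simp [pow_succ]

/-- The coordinates of `a (b x)` and `b (a x)` are put together in the algebra obtained from
`F[X] ⧸ (p i)` by adjoining `ω` with `ω ^ 2 = 1`; the resulting map is semilinear along
`X ↦ ω * X`. This replaces the sign change `X ↦ -X` in a way that works in characteristic two. -/
theorem isEvenPoly_or_isOddPoly_of_sq_eq_zero (hp : ∀ i j, i ≤ j → p j ∣ p i)
    (hmonic : ∀ i, (p i).Monic)
    (E : M ≃ₗ[F[X]] ⨁ j, F[X] ⧸ Ideal.span {p j}) {a b : Module.End F M}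
    (ha : a ^ 2 = 0) (hb : b ^ 2 = 0) (hab : ∀ x, (X : F[X]) • x = a x + b x) (i : Fin r) :
    IsEvenPoly (p i) ∨ IsOddPoly (p i) := by
  let Q := F[X] ⧸ Ideal.span {p i}
  let B := QuadraticAlgebra Q 1 0
  let mk : F[X] → Q := Ideal.Quotient.mk _
  have hmk : ∀ (f : F[X]) (q : Q), f • q = mk f * q := fun f q => Algebra.smul_def f q
  let σ : F[X] → B := fun f => ⟨mk (evenPart f), mk (f - evenPart f)⟩
  let S : M →+ (Fin (i + 1) → B) :=
    { toFun x m := ⟨reducedCoord hp E i m (a (b x)), reducedCoord hp E i m (b (a x))⟩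
      map_zero' := by ext m <;> simp
      map_add' x y := by ext m <;> simp }
  have hS : ∀ (f : F[X]) x, S (f • x) = σ f • S x := by
    intro f x
    obtain ⟨h1, h2⟩ := mul_smul_of_sq_eq_zero ha hb hab f x
    ext1 m
    change (⟨_, _⟩ : B) = ⟨_, _⟩ * ⟨_, _⟩
    rw [quadraticAlgebra_mk_mul_mk, h1, h2]
    simp only [map_add, map_smul, hmk]
  let c : B := ⟨mk (X ^ 4), 0⟩
  have hc : ∀ m, c • Pi.single m (1 : B) ∈ Submodule.span B (Set.range S) := by
    intro m
    obtain ⟨x, hx⟩ := exists_reducedCoord_eq hp E i m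
    have ha' : ∀ x, a (a x) = 0 := fun x => by
      simpa [sq] using LinearMap.congr_fun ha x
    have hb' : ∀ x, b (b x) = 0 := fun x => by
      simpa [sq] using LinearMap.congr_fun hb x
    -- The factor `X ^ 4` comes from `(a + b) ^ 4 = (a * b) ^ 2 + (b * a) ^ 2`.
    have hX : a (b (a (b x))) + b (a (b (a x))) = (X ^ 4 : F[X]) • x := by
      have h4 : (X ^ 4 : F[X]) = X * (X * (X * X)) := by ring
      simp [h4, mul_smul, hab, ha', hb']
    have : c • Pi.single m (1 : B) = S (a (b x)) + (⟨0, 1⟩ : B) • S (b (a x)) := by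
      ext1 m'
      have h := congrArg (reducedCoord hp E i m') hX
      rw [map_smul, hx, hmk, map_add] at h
      have hR : (⟨0, 1⟩ : B) * S (b (a x)) m' = ⟨reducedCoord hp E i m' (b (a (b (a x)))), 0⟩ := by
        change (⟨_, _⟩ : B) * ⟨_, _⟩ = _
        rw [quadraticAlgebra_mk_mul_mk, hb', map_zero, map_zero]
        simp
      have hL : S (a (b x)) m' = ⟨reducedCoord hp E i m' (a (b (a (b x)))), 0⟩ := by
        change (⟨_, _⟩ : B) = _
        rw [ha', map_zero, map_zero]
      have hadd : ∀ s t : Q, (⟨s, 0⟩ + ⟨t, 0⟩ : B) = ⟨s + t, 0⟩ := fun s t =>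
        congrArg (fun z : Q => (⟨s + t, z⟩ : B)) (add_zero 0)
      rw [Pi.add_apply, Pi.smul_apply, Pi.smul_apply, smul_eq_mul, smul_eq_mul, hR, hL,
        hadd, h]
      by_cases hm : m' = m
      · subst hm
        rw [Pi.single_eq_same, Pi.single_eq_same, mul_one, mul_one]
      · rw [Pi.single_eq_of_ne hm, Pi.single_eq_of_ne hm, mul_zero, mul_zero]
        rfl
    rw [this]
    exact add_mem (Submodule.subset_span ⟨_, rfl⟩)
      (Submodule.smul_mem _ _ (Submodule.subset_span ⟨_, rfl⟩))
  have key := mul_pow_eq_zero_of_semilinear hp E i σ c S hS hc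
  rw [show c = ⟨mk (X ^ 4), 0⟩ from rfl, quadraticAlgebra_mk_zero_pow,
    quadraticAlgebra_mk_mul_mk, mul_zero, mul_zero, add_zero, zero_add] at key
  have hmk_mul : ∀ f, mk (X ^ (4 * (i + 1 : ℕ)) * f) = mk f * mk (X ^ 4) ^ (i + 1 : ℕ) := by
    intro f
    rw [pow_mul]
    simp only [mk, map_mul, map_pow]
    rw [mul_comm]
  have hdvd : ∀ f, mk f = 0 → p i ∣ f := fun f hf =>
    Ideal.mem_span_singleton.1 (Ideal.Quotient.eq_zero_iff_mem.1 hf)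
  refine isEvenPoly_or_isOddPoly_of_dvd_X_pow_mul (hmonic i).ne_zero (n := 4 * (i + 1))
    (hdvd _ ?_) (hdvd _ ?_)
  · rw [hmk_mul]
    exact congrArg QuadraticAlgebra.re key
  · rw [hmk_mul]
    exact congrArg QuadraticAlgebra.im key

lemma comp_neg_X_eq (f : F[X]) : f.comp (-X) = evenPart f - (f - evenPart f) := by
  induction f using polynomial_induction with
  | one =>
    rw [one_comp, evenPart_one]
    ring
  | add f g hf hg => rw [add_comp, hf, hg, map_add]; ring
  | smul c f hf => rw [smul_comp, hf, map_smul, ← smul_sub, ← smul_sub]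
  | X_mul f hf => rw [mul_comp, X_comp, hf, evenPart_X_mul]; ring

/-- A similarity `φ` from `X` to `-X` is semilinear along `X ↦ -X`, hence each `p i` divides
`(p i)(-X)`. -/
theorem isEvenPoly_or_isOddPoly_of_similar_neg (h2 : ringChar F ≠ 2)
    (hp : ∀ i j, i ≤ j → p j ∣ p i)
    (E : M ≃ₗ[F[X]] ⨁ j, F[X] ⧸ Ideal.span {p j}) (φ : M ≃ₗ[F] M)
    (hφ : ∀ x, φ ((X : F[X]) • x) = -((X : F[X]) • φ x)) (i : Fin r) :
    IsEvenPoly (p i) ∨ IsOddPoly (p i) := by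
  let Q := F[X] ⧸ Ideal.span {p i}
  let mk : F[X] → Q := Ideal.Quotient.mk _
  have hmk : ∀ (f : F[X]) (q : Q), f • q = mk f * q := fun f q => Algebra.smul_def f q
  have hφ' : ∀ (f : F[X]) x, φ (f • x) = f.comp (-X) • φ x := by
    intro f x
    induction f using polynomial_induction with
    | one => simp
    | add f g hf hg => simp [add_smul, hf, hg]
    | smul c f hf => simp [smul_assoc, hf]
    | X_mul f hf => rw [mul_smul, hφ, hf]; simp [mul_smul]
  let S : M →+ (Fin (i + 1) → Q) :=
    { toFun x m := reducedCoord hp E i m (φ x)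
      map_zero' := by ext m; simp
      map_add' x y := by ext m; simp }
  have key := mul_pow_eq_zero_of_semilinear hp E i (fun f => mk (f.comp (-X))) 1 S
    (fun f x => by ext m; simp [S, hφ', hmk]) (fun m => by
      obtain ⟨x, hx⟩ := exists_reducedCoord_eq hp E i m
      refine Submodule.subset_span ⟨φ.symm x, ?_⟩
      ext m'
      simp [S, hx])
  rw [one_pow, mul_one] at key
  have h3 : p i ∣ evenPart (p i) - (p i - evenPart (p i)) := by
    rw [← comp_neg_X_eq]
    exact Ideal.mem_span_singleton.1 (Ideal.Quotient.eq_zero_iff_mem.1 key)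
  have h4 : p i ∣ evenPart (p i) := by
    have h5 : p i ∣ C (2 : F) * evenPart (p i) := by
      have : C (2 : F) * evenPart (p i) = (evenPart (p i) - (p i - evenPart (p i))) + p i := by
        rw [C_ofNat]
        ring
      rw [this]
      exact dvd_add h3 dvd_rfl
    have hu : IsUnit (C (2 : F)) := isUnit_C.2 (Ring.two_ne_zero h2).isUnit
    exact (hu.dvd_mul_left).1 h5
  exact isEvenPoly_or_isOddPoly_of_dvd h4 (dvd_sub_self_left.2 h4)

end Comparison

/-! ### Vectors of maximal order -/

section MaximalOrder

variable {F M : Type*} [Field F] [AddCommGroup M] [Module F[X] M] [Module F M]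
  [IsScalarTower F F[X] M] [FiniteDimensional F M]

variable (F M) in
lemma exists_ne_zero_smul_eq_zero : ∃ m : F[X], m ≠ 0 ∧ ∀ x : M, m • x = 0 := by
  let φ := Algebra.lsmul (A := F[X]) F F M
  refine ⟨minpoly F (φ X), minpoly.ne_zero (Algebra.IsIntegral.isIntegral _), fun x => ?_⟩
  have h := minpoly.aeval F (φ X)
  rw [aeval_algHom_apply, aeval_X_left_apply] at h
  exact LinearMap.congr_fun h x

variable (F) in
lemma exists_monic_smul_eq_zero_iff (x : M) :
    ∃ p : F[X], p.Monic ∧ ∀ f : F[X], f • x = 0 ↔ p ∣ f := by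
  classical
  obtain ⟨m, hm, hmx⟩ := exists_ne_zero_smul_eq_zero F M
  let I := Ideal.torsionOf F[X] M x
  obtain ⟨g, hg⟩ := IsPrincipalIdealRing.principal I
  have hI : ∀ f : F[X], f • x = 0 ↔ g ∣ f := fun f => by
    rw [← Ideal.mem_torsionOf_iff, ← Ideal.mem_span_singleton]
    change f ∈ I ↔ _
    rw [hg]
  have hg0 : g ≠ 0 := fun h => hm (zero_dvd_iff.1 (h ▸ (hI m).1 (hmx x)))
  refine ⟨normalize g, monic_normalize hg0, fun f => ?_⟩
  rw [hI, normalize_dvd_iff]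

variable (F M) in
/-- Some vector of `M` has for annihilator the annihilator of `M`. If the order `P` of a vector `x`
has maximal degree and some `y` has an order `Q` not dividing `P`, a prime power `π ^ k` dividing
`Q` but not `P` allows one to replace the `π`-part of `P` with `π ^ k`, contradicting
maximality. -/
lemma exists_smul_eq_zero_iff_forall : ∃ (x : M) (p : F[X]), p.Monic ∧
    (∀ f : F[X], f • x = 0 ↔ p ∣ f) ∧ ∀ y : M, p • y = 0 := by
  obtain ⟨m, hm, hmx⟩ := exists_ne_zero_smul_eq_zero F M
  choose p hmonic hp using exists_monic_smul_eq_zero_iff F (M := M)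
  have hle : ∀ x, (p x).natDegree ≤ m.natDegree := fun x =>
    natDegree_le_of_dvd ((hp x m).1 (hmx x)) hm
  let x := Function.argmin fun x : M => m.natDegree - (p x).natDegree
  have hx : ∀ y, (p y).natDegree ≤ (p x).natDegree := fun y => by
    have := Function.argmin_le (fun x : M => m.natDegree - (p x).natDegree) y
    have h1 := hle x
    have h2 := hle y
    change m.natDegree - (p x).natDegree ≤ m.natDegree - (p y).natDegree at this
    omega
  refine ⟨x, p x, hmonic x, hp x, fun y => ?_⟩
  rw [hp y]
  by_contra hdvd
  rw [UniqueFactorizationMonoid.dvd_iff_emultiplicity_le (hmonic y).ne_zero] at hdvd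
  push Not at hdvd
  obtain ⟨π, hπ, hlt⟩ := hdvd
  have hfin : FiniteMultiplicity π (p x) :=
    FiniteMultiplicity.of_prime_left hπ (hmonic x).ne_zero
  obtain ⟨P, hP, hπP⟩ := hfin.exists_eq_pow_mul_and_not_dvd
  set a := multiplicity π (p x)
  have hdy : π ^ (a + 1) ∣ p y := by
    refine pow_dvd_of_le_emultiplicity ?_
    rw [hfin.emultiplicity_eq_multiplicity] at hlt
    exact_mod_cast Order.add_one_le_of_lt hlt
  obtain ⟨Q, hQ⟩ := hdy
  have hP0 : P ≠ 0 := fun h => (hmonic x).ne_zero (by rw [hP, h, mul_zero])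
  have hQ0 : Q ≠ 0 := fun h => (hmonic y).ne_zero (by rw [hQ, h, mul_zero])
  have hco : IsCoprime (π ^ (a + 1)) P := (hπ.irreducible.coprime_iff_not_dvd.2 hπP).pow_left
  have h1 : ∀ f : F[X], f • (π ^ a • x) = 0 ↔ P ∣ f := fun f => by
    rw [smul_smul, hp, hP, mul_comm f]
    exact mul_dvd_mul_iff_left (pow_ne_zero _ hπ.ne_zero)
  have h2 : ∀ f : F[X], f • (Q • y) = 0 ↔ π ^ (a + 1) ∣ f := fun f => by
    rw [smul_smul, hp, hQ]
    exact mul_dvd_mul_iff_right hQ0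
  set z := π ^ a • x + Q • y with hz
  have hpz : p z • z = 0 := (hp z _).2 dvd_rfl
  rw [hz, smul_add, ← hz] at hpz
  have h3 : P ∣ p z := by
    have : (π ^ (a + 1) * p z) • (π ^ a • x) = 0 := by
      rw [mul_smul, eq_neg_of_add_eq_zero_left hpz, smul_neg, smul_smul,
        (h2 _).2 (dvd_mul_right _ _), neg_zero]
    exact hco.symm.dvd_of_dvd_mul_left ((h1 _).1 this)
  have h4 : π ^ (a + 1) ∣ p z := by
    have : (P * p z) • (Q • y) = 0 := by
      rw [mul_smul, eq_neg_of_add_eq_zero_right hpz, smul_neg, smul_smul,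
        (h1 _).2 (dvd_mul_right _ _), neg_zero]
    exact hco.dvd_of_dvd_mul_left ((h2 _).1 this)
  have h5 := natDegree_le_of_dvd (hco.mul_dvd h4 h3) (hmonic z).ne_zero
  have h6 : (π ^ (a + 1) * P).natDegree = π.natDegree + (p x).natDegree := by
    rw [pow_succ', mul_assoc, ← hP, natDegree_mul hπ.ne_zero (hmonic x).ne_zero]
  have h7 := hπ.irreducible.natDegree_pos
  have h8 := hx z
  omega

end MaximalOrder

/-! ### Lagrangian decomposition of a symplectic `F[X]`-module -/

section Lagrangian

variable {F : Type*} [Field F]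

/-- The linear form `f ↦ coeff (f mod p) (deg p - 1)`, which induces a perfect pairing on
`F[X] ⧸ (p)`. -/
noncomputable def topCoeffMod (p : F[X]) : F[X] →ₗ[F] F :=
  lcoeff F (p.natDegree - 1) ∘ₗ modByMonicHom p

lemma topCoeffMod_eq_zero_of_dvd {p f : F[X]} (hp : p.Monic) (h : p ∣ f) :
    topCoeffMod p f = 0 := by
  simp [topCoeffMod, modByMonicHom, (modByMonic_eq_zero_iff_dvd hp).2 h]

lemma dvd_of_topCoeffMod_mul_eq_zero {p f : F[X]} (hp : p.Monic)
    (h : ∀ g, topCoeffMod p (g * f) = 0) : p ∣ f := by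
  rw [← modByMonic_eq_zero_iff_dvd hp]
  by_contra hr
  have hp1 : p ≠ 1 := fun h1 => hr (by rw [h1, modByMonic_one])
  have hlt := natDegree_modByMonic_lt f hp hp1
  set k := f %ₘ p with hk
  -- Multiplication by this power of `X` brings the remainder to degree `natDegree p - 1`.
  have h1 := h (X ^ (p.natDegree - 1 - k.natDegree))
  have h2 : X ^ (p.natDegree - 1 - k.natDegree) * f =
      X ^ (p.natDegree - 1 - k.natDegree) * k +
        p * (X ^ (p.natDegree - 1 - k.natDegree) * (f /ₘ p)) := by
    conv_lhs => rw [← modByMonic_add_div f p]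
    rw [← hk]
    ring
  rw [h2, map_add, topCoeffMod_eq_zero_of_dvd hp (dvd_mul_right _ _), add_zero] at h1
  have h3 : (X ^ (p.natDegree - 1 - k.natDegree) * k) %ₘ p =
      X ^ (p.natDegree - 1 - k.natDegree) * k := by
    rw [modByMonic_eq_self_iff hp]
    refine degree_lt_degree ?_
    rw [natDegree_X_pow_mul _ hr]
    omega
  have h4 : p.natDegree - 1 = k.natDegree + (p.natDegree - 1 - k.natDegree) := by omega
  change ((X ^ (p.natDegree - 1 - k.natDegree) * k) %ₘ p).coeff (p.natDegree - 1) = 0 at h1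
  rw [h3] at h1
  nth_rewrite 2 [h4] at h1
  rw [coeff_X_pow_mul, coeff_natDegree, leadingCoeff_eq_zero] at h1
  exact hr h1

section

variable {M : Type*} [AddCommGroup M] [Module F[X] M] [Module F M] [IsScalarTower F F[X] M]
  {b : LinearMap.BilinForm F M}

lemma smul_left_eq_smul_right (hb : b.IsAlt) (hX : ∀ x, b x ((X : F[X]) • x) = 0) (f : F[X])
    (x y : M) : b (f • x) y = b x (f • y) := by
  induction f using polynomial_induction generalizing x y with
  | one => simp
  | add f g hf hg => simp [add_smul, hf, hg]
  | smul c f hf => simp [smul_assoc, hf]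
  | X_mul f hf =>
    have h := hX (f • x + y)
    simp only [smul_add, map_add, LinearMap.add_apply, hX, add_zero, zero_add] at h
    rw [mul_smul, mul_comm, mul_smul, ← hf, ← hb.neg_eq, neg_eq_iff_add_eq_zero]
    exact h

/-- Cyclic submodules are isotropic: `b x (X ^ (2 * k) • x) = b (X ^ k • x) (X ^ k • x) = 0`, and
odd exponents are dealt with in the same way by means of `hX`. -/
lemma apply_smul_smul_self (hb : b.IsAlt) (hX : ∀ x, b x ((X : F[X]) • x) = 0) (f g : F[X])
    (x : M) : b (f • x) (g • x) = 0 := by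
  rw [smul_left_eq_smul_right hb hX, ← mul_smul]
  induction f * g using Polynomial.induction_on' with
  | add f g hf hg => rw [add_smul, map_add, hf, hg, add_zero]
  | monomial n a =>
    rw [← mul_one a, ← smul_eq_mul, ← smul_monomial, monomial_one_right_eq_X_pow, smul_assoc,
      map_smul]
    obtain ⟨k, rfl | rfl⟩ := n.even_or_odd'
    · rw [two_mul, pow_add, mul_smul, ← smul_left_eq_smul_right hb hX, hb, smul_zero]
    · rw [two_mul, pow_succ, pow_add, mul_assoc, mul_comm _ X, mul_smul,
        ← smul_left_eq_smul_right hb hX, mul_smul, hX, smul_zero]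

variable [FiniteDimensional F M]

/-- A vector `x` of order `p` can be completed to a hyperbolic pair `(x, y)` over `F[X]`. -/
lemma exists_apply_smul_eq_topCoeffMod (hnd : b.Nondegenerate) {x : M} {p : F[X]} (hp : p.Monic)
    (hx : ∀ f : F[X], f • x = 0 ↔ p ∣ f) :
    ∃ y, ∀ f : F[X], b y (f • x) = topCoeffMod p f := by
  let j : F[X] →ₗ[F] M := (LinearMap.toSpanSingleton F[X] M x).restrictScalars F
  have h : topCoeffMod p ∈ LinearMap.range j.dualMap := by
    rw [LinearMap.range_dualMap_eq_dualAnnihilator_ker, Submodule.mem_dualAnnihilator]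
    exact fun f hf => topCoeffMod_eq_zero_of_dvd hp ((hx f).1 hf)
  obtain ⟨l, hl⟩ := h
  refine ⟨(b.toDual hnd).symm l, fun f => ?_⟩
  rw [LinearMap.BilinForm.apply_toDual_symm_apply, ← hl]
  rfl

/-- The span of a hyperbolic pair whose order kills `M` splits off orthogonally. -/
lemma exists_hyperbolic_splitting (hb : b.IsAlt) (hnd : b.Nondegenerate)
    (hX : ∀ x, b x ((X : F[X]) • x) = 0) {x y : M} {p : F[X]} (hp : p.Monic)
    (hpM : ∀ z : M, p • z = 0) (hxy : ∀ f : F[X], b y (f • x) = topCoeffMod p f) :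
    ∃ (W : Submodule F[X] M)
      (e : (((F[X] ⧸ Ideal.span {p}) × (F[X] ⧸ Ideal.span {p})) × W) ≃ₗ[F[X]] M),
      (b.restrict (W.restrictScalars F)).Nondegenerate ∧
      (∀ f f' w w', b (e ((f, 0), w)) (e ((f', 0), w')) = b w w') ∧
      (∀ g g' w w', b (e ((0, g), w)) (e ((0, g'), w')) = b w w') := by
  have hs := smul_left_eq_smul_right hb hX
  have hiso := apply_smul_smul_self hb hX
  have hyx : ∀ f g : F[X], b (g • y) (f • x) = topCoeffMod p (g * f) := fun f g => by
    rw [hs, ← mul_smul, hxy]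
  let N : Submodule F[X] M := Submodule.span F[X] {x, y}
  have hN : ∀ z, z ∈ N ↔ ∃ f g : F[X], f • x + g • y = z := fun z => Submodule.mem_span_pair
  let W : Submodule F[X] M :=
    { carrier := {w | ∀ n ∈ N, b n w = 0}
      add_mem' := fun {w w'} h h' n hn => by rw [map_add, h n hn, h' n hn, add_zero]
      zero_mem' := fun n _ => map_zero _
      smul_mem' := fun f w h n hn => by rw [← hs]; exact h _ (N.smul_mem f hn) }
  -- A vector of `N` is determined by its pairings with the multiples of `x` and of `y`.
  have hsep : ∀ f g : F[X], (∀ n ∈ N, b n (f • x + g • y) = 0) → p ∣ f ∧ p ∣ g := by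
    intro f g h
    constructor
    · refine dvd_of_topCoeffMod_mul_eq_zero hp fun k => ?_
      have := h (k • y) (N.smul_mem _ (Submodule.subset_span (by simp)))
      rwa [map_add, hiso, add_zero, hyx] at this
    · refine dvd_of_topCoeffMod_mul_eq_zero hp fun k => ?_
      have := h (k • x) (N.smul_mem _ (Submodule.subset_span (by simp)))
      rwa [map_add, hiso, zero_add, ← hb.neg_eq, hyx, neg_eq_zero, mul_comm] at this
  have hcompl : IsCompl (N.restrictScalars F) (b.orthogonal (N.restrictScalars F)) := by
    refine LinearMap.BilinForm.isCompl_orthogonal_of_restrict_nondegenerate hb.isRefl ?_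
    have hr : (b.restrict (N.restrictScalars F)).IsRefl := fun u v h => hb.isRefl _ _ h
    refine hr.nondegenerate_iff_separatingRight.2 ?_
    rintro ⟨z, hz⟩ h
    obtain ⟨f, g, rfl⟩ := (hN z).1 hz
    obtain ⟨⟨f, rfl⟩, ⟨g, rfl⟩⟩ := hsep f g fun n hn => h ⟨n, hn⟩
    ext
    simp [mul_smul, hpM]
  have hWorth : b.orthogonal (N.restrictScalars F) = W.restrictScalars F := by
    ext; rfl
  rw [hWorth] at hcompl
  let q : M → (F[X] ⧸ Ideal.span {p}) →ₗ[F[X]] M := fun z =>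
    Submodule.liftQ (Ideal.span {p}) (LinearMap.toSpanSingleton F[X] M z) (by
      rw [Ideal.span_le, Set.singleton_subset_iff]
      exact hpM z)
  have hq : ∀ z f, q z (Ideal.Quotient.mk _ f) = f • z := fun z f => rfl
  let Φ : (((F[X] ⧸ Ideal.span {p}) × (F[X] ⧸ Ideal.span {p})) × W) →ₗ[F[X]] M :=
    ((q x).coprod (q y)).coprod W.subtype
  have hΦ : ∀ f g w, Φ ((Ideal.Quotient.mk _ f, Ideal.Quotient.mk _ g), w) =
      f • x + g • y + w := fun f g w => by
    simp [Φ, hq]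
  have hbij : Function.Bijective Φ := by
    constructor
    · rw [← LinearMap.ker_eq_bot, LinearMap.ker_eq_bot']
      rintro ⟨⟨f, g⟩, w⟩ h
      obtain ⟨f, rfl⟩ := Ideal.Quotient.mk_surjective f
      obtain ⟨g, rfl⟩ := Ideal.Quotient.mk_surjective g
      rw [hΦ] at h
      obtain ⟨hf, hg⟩ := hsep f g fun n hn => by
        rw [eq_neg_of_add_eq_zero_left h, map_neg, w.2 n hn, neg_zero]
      have hw : w = 0 := by
        obtain ⟨f, rfl⟩ := hf
        obtain ⟨g, rfl⟩ := hg
        ext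
        simpa [mul_smul, hpM] using h
      rw [hw, Ideal.Quotient.eq_zero_iff_mem.2 (Ideal.mem_span_singleton.2 hf),
        Ideal.Quotient.eq_zero_iff_mem.2 (Ideal.mem_span_singleton.2 hg)]
      rfl
    · intro z
      have hz : z ∈ N.restrictScalars F ⊔ W.restrictScalars F := by
        rw [hcompl.sup_eq_top]
        trivial
      obtain ⟨n, hn, w, hw, rfl⟩ := Submodule.mem_sup.1 hz
      obtain ⟨f, g, rfl⟩ := (hN n).1 hn
      exact ⟨((Ideal.Quotient.mk _ f, Ideal.Quotient.mk _ g), ⟨w, hw⟩), hΦ _ _ _⟩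
  have hx : x ∈ N := Submodule.subset_span (by simp)
  have hy : y ∈ N := Submodule.subset_span (by simp)
  have hWN : ∀ (w : W), ∀ n ∈ N, b w n = 0 := fun w n hn => hb.isRefl _ _ (w.2 n hn)
  refine ⟨W, LinearEquiv.ofBijective Φ hbij, ?_, fun f f' w w' => ?_, fun g g' w w' => ?_⟩
  · have hr : (b.restrict (W.restrictScalars F)).IsRefl := fun u v h => hb.isRefl _ _ h
    refine hr.nondegenerate_iff_separatingRight.2 ?_
    rintro ⟨w, hw⟩ h
    ext
    refine hnd.2 w fun z => ?_
    have hz : z ∈ N.restrictScalars F ⊔ W.restrictScalars F := by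
      rw [hcompl.sup_eq_top]
      trivial
    obtain ⟨n, hn, w', hw', rfl⟩ := Submodule.mem_sup.1 hz
    rw [map_add, LinearMap.add_apply, hw n hn, zero_add]
    exact h ⟨w', hw'⟩
  · obtain ⟨f, rfl⟩ := Ideal.Quotient.mk_surjective f
    obtain ⟨f', rfl⟩ := Ideal.Quotient.mk_surjective f'
    rw [← map_zero (Ideal.Quotient.mk (Ideal.span {p})), LinearEquiv.ofBijective_apply,
      LinearEquiv.ofBijective_apply, hΦ, hΦ, zero_smul, add_zero]
    simp only [map_add, LinearMap.add_apply, hiso, w'.2 _ (N.smul_mem f hx),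
      hWN w _ (N.smul_mem f' hx), zero_add, add_zero]
  · obtain ⟨g, rfl⟩ := Ideal.Quotient.mk_surjective g
    obtain ⟨g', rfl⟩ := Ideal.Quotient.mk_surjective g'
    rw [← map_zero (Ideal.Quotient.mk (Ideal.span {p})), LinearEquiv.ofBijective_apply,
      LinearEquiv.ofBijective_apply, hΦ, hΦ, zero_smul, zero_add]
    simp only [map_add, LinearMap.add_apply, hiso, w'.2 _ (N.smul_mem g hy),
      hWN w _ (N.smul_mem g' hy), zero_add, add_zero]

end

/-- Every symplectic `F[X]`-module is the direct sum of two isotropic submodules which have the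
same invariant factors. -/
theorem exists_lagrangian_decomposition {F : Type*} [Field F] (n : ℕ) :
    ∀ (M : Type*) [AddCommGroup M] [Module F[X] M] [Module F M] [IsScalarTower F F[X] M]
      [FiniteDimensional F M] (b : LinearMap.BilinForm F M), Module.finrank F M = n →
      b.IsAlt → b.Nondegenerate → (∀ x, b x ((X : F[X]) • x) = 0) →
      ∃ (r : ℕ) (p : Fin r → F[X])
        (e : M ≃ₗ[F[X]] (∀ i, F[X] ⧸ Ideal.span {p i}) × (∀ i, F[X] ⧸ Ideal.span {p i})),
        (∀ i, (p i).Monic) ∧ (∀ i, 0 < (p i).natDegree) ∧ (∀ i j, i ≤ j → p j ∣ p i) ∧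
        (∀ f f', b (e.symm (f, 0)) (e.symm (f', 0)) = 0) ∧
        (∀ g g', b (e.symm (0, g)) (e.symm (0, g')) = 0) := by
  induction n using Nat.strong_induction_on with
  | _ n ih =>
  intro M _ _ _ _ _ b hn hb hnd hX
  rcases subsingleton_or_nontrivial M with hM | hM
  · exact ⟨0, Fin.elim0, LinearEquiv.ofSubsingleton _ _, fun i => i.elim0, fun i => i.elim0,
      fun i => i.elim0, fun f f' => by rw [Subsingleton.elim (LinearEquiv.symm _ (f, 0)) 0, map_zero]; rfl,
      fun f f' => by rw [Subsingleton.elim (LinearEquiv.symm _ _) 0, map_zero]; rfl⟩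
  obtain ⟨x, p₀, hp₀, hx, hpM⟩ := exists_smul_eq_zero_iff_forall F M
  obtain ⟨y, hxy⟩ := exists_apply_smul_eq_topCoeffMod hnd hp₀ hx
  obtain ⟨W, e₀, hWnd, h₁, h₂⟩ := exists_hyperbolic_splitting hb hnd hX hp₀ hpM hxy
  have hdeg : 0 < p₀.natDegree := by
    rw [hp₀.natDegree_pos]
    rintro rfl
    obtain ⟨z, hz⟩ := exists_ne (0 : M)
    exact hz (by simpa using hpM z)
  have hlt : Module.finrank F W < n := by
    -- The image of `W` misses the class of `1` in the first factor.
    let j : W →ₗ[F] M := (e₀.toLinearMap ∘ₗ LinearMap.inr F[X] _ W).restrictScalars F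
    have hj : Function.Injective j := e₀.injective.comp LinearMap.inr_injective
    rw [← hn, ← LinearMap.finrank_range_of_inj hj]
    refine Submodule.finrank_lt fun htop => ?_
    obtain ⟨w, hw⟩ : e₀ ((Ideal.Quotient.mk _ 1, 0), 0) ∈ LinearMap.range j := by
      rw [htop]
      trivial
    have h := congrArg (fun v => v.1.1) (e₀.injective hw)
    have h1 := Ideal.mem_span_singleton.1 (Ideal.Quotient.eq_zero_iff_mem.1 h.symm)
    exact hp₀.natDegree_pos.1 hdeg (hp₀.eq_one_of_isUnit (isUnit_of_dvd_one h1))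
  have : FiniteDimensional F W := inferInstanceAs (FiniteDimensional F (W.restrictScalars F))
  let bW : LinearMap.BilinForm F W := b.restrict (W.restrictScalars F)
  obtain ⟨r, p, e, hmonic, hpos, hdvd, h₃, h₄⟩ := ih _ hlt W bW rfl
    (fun w => hb w) hWnd (fun w => hX w)
  have hp₀p : ∀ i, p i ∣ p₀ := fun i => by
    classical
    have h := congrArg (fun v => (e v).1 i)
      (show p₀ • e.symm (Pi.single i (Ideal.Quotient.mk _ 1), 0) = 0 from Subtype.ext (hpM _))
    simp only [map_smul, LinearEquiv.apply_symm_apply, map_zero, Prod.smul_fst, Pi.smul_apply,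
      Pi.single_eq_same, Prod.fst_zero, Pi.zero_apply] at h
    rw [← Ideal.Quotient.mk_eq_mk, ← Submodule.Quotient.mk_smul, smul_eq_mul, mul_one,
      Ideal.Quotient.mk_eq_mk] at h
    exact Ideal.mem_span_singleton.1 (Ideal.Quotient.eq_zero_iff_mem.1 h)
  let p' : Fin (r + 1) → F[X] := Fin.cons p₀ p
  let cons := Fin.consLinearEquiv F[X] fun i => F[X] ⧸ Ideal.span {p' i}
  let e' : M ≃ₗ[F[X]] (∀ i, F[X] ⧸ Ideal.span {p' i}) × (∀ i, F[X] ⧸ Ideal.span {p' i}) :=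
    e₀.symm ≪≫ₗ (LinearEquiv.refl _ _).prodCongr e ≪≫ₗ
      LinearEquiv.prodProdProdComm F[X] _ _ _ _ ≪≫ₗ cons.prodCongr cons
  refine ⟨r + 1, p', e', Fin.cases hp₀ hmonic, Fin.cases hdeg hpos, ?_, fun f f' => ?_,
    fun g g' => ?_⟩
  · intro i j hij
    cases j using Fin.cases with
    | zero => rw [Fin.le_zero_iff.1 hij]
    | succ j =>
      cases i using Fin.cases with
      | zero => exact hp₀p j
      | succ i => exact hdvd i j (Fin.succ_le_succ_iff.1 hij)
  · exact (h₁ _ _ _ _).trans (h₃ _ _)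
  · exact (h₂ _ _ _ _).trans (h₄ _ _)

end Lagrangian

/-! ### Lagrangian gradings -/

section Grading

variable {F V : Type*} [Field F] [AddCommGroup V] [Module F V]

/-- A module `F[X] ⧸ (p)` with `p` even or odd is graded by `ℤ/2`, with `X` odd; here `ρ` is the
projection onto the even component. -/
lemma exists_proj_quotient {p : F[X]} (hp : IsEvenPoly p ∨ IsOddPoly p) :
    ∃ ρ : Module.End F (F[X] ⧸ Ideal.span {p}), (∀ q, ρ (ρ q) = ρ q) ∧
      ∀ q, ρ ((X : F[X]) • q) = (X : F[X]) • (q - ρ q) := by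
  let mk : F[X] →ₗ[F] F[X] ⧸ Ideal.span {p} :=
    (Submodule.mkQ (Ideal.span {p})).restrictScalars F
  have hker : (Ideal.span {p}).restrictScalars F ≤ LinearMap.ker (mk ∘ₗ evenPart) := by
    intro f hf
    exact Ideal.Quotient.eq_zero_iff_mem.2 (Ideal.mem_span_singleton.2
      (dvd_evenPart_of_dvd hp (Ideal.mem_span_singleton.1 hf)))
  let ρ : Module.End F (F[X] ⧸ Ideal.span {p}) :=
    Submodule.liftQ ((Ideal.span {p}).restrictScalars F) (mk ∘ₗ evenPart) hker ∘ₗ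
      (Submodule.Quotient.restrictScalarsEquiv F (Ideal.span {p})).symm.toLinearMap
  have hρ : ∀ f, ρ (mk f) = mk (evenPart f) := fun f => rfl
  have hX : ∀ f, (X : F[X]) • mk f = mk (X * f) := fun f => rfl
  refine ⟨ρ, fun q => ?_, fun q => ?_⟩
  · obtain ⟨f, rfl⟩ : ∃ f, mk f = q := Ideal.Quotient.mk_surjective q
    rw [hρ, hρ, evenPart_evenPart]
  · obtain ⟨f, rfl⟩ : ∃ f, mk f = q := Ideal.Quotient.mk_surjective q
    rw [hX, hρ, hρ, evenPart_X_mul, ← map_sub, hX]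

variable {b : LinearMap.BilinForm F V} {u : Module.End F V}

/-- Let `τ` be a projection commuting with `u` whose image and kernel are Lagrangian. A grading of
the image of `τ` for which `u` is odd, given by the projection `R`, extends to a grading of `V`
whose components are Lagrangian: the kernel of `τ` is dual to the image, and it receives the dual
grading, with the two components exchanged. -/
lemma exists_lagrangian_grading [FiniteDimensional F V] (hb : b.IsAlt) (hnd : b.Nondegenerate)
    (hu : ∀ x y, b (u x) y = b x (u y)) {τ R : Module.End F V}
    (hττ : ∀ x, τ (τ x) = τ x) (hbτ : ∀ x y, b (τ x) y = b x (y - τ y))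
    (hτR : ∀ x, τ (R x) = R x) (hRτ : ∀ x, R (τ x) = R x) (hRR : ∀ x, R (R x) = R x)
    (hRu : ∀ x, R (u x) = u (τ x) - u (R x)) (huτ : ∀ x, τ (u x) = u (τ x)) :
    ∃ π : Module.End F V, (∀ x, π (π x) = π x) ∧ (∀ x, π (u x) = u (x - π x)) ∧
      ∀ x y, b (π x) y = b x (y - π y) := by
  have hext : ∀ x x', (∀ y, b x y = b x' y) → x = x' := fun x x' h => by
    rw [← sub_eq_zero]
    exact hnd.1 _ fun y => by rw [map_sub, LinearMap.sub_apply, h, sub_self]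
  let S : Module.End F V := b.leftAdjointOfNondegenerate hnd R
  have hS : ∀ x y, b (S x) y = b x (R y) :=
    LinearMap.BilinForm.isAdjointPairLeftAdjointOfNondegenerate b hnd R
  have hS' : ∀ x y, b (R x) y = b x (S y) := fun x y => by
    rw [← hb.neg_eq, ← hS, hb.neg_eq]
  have hSS : ∀ x, S (S x) = S x := fun x => hext _ _ fun y => by rw [hS, hS, hS, hRR]
  have hSτ : ∀ x, S (τ x) = 0 := fun x => hext _ _ fun y => by
    rw [hS, hbτ, hτR, sub_self, map_zero, map_zero, LinearMap.zero_apply]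
  have hτS : ∀ x, τ (S x) = 0 := fun x => hext _ _ fun y => by
    rw [hbτ, hS, map_sub, hRτ, sub_self, map_zero, map_zero, LinearMap.zero_apply]
  have hRS : ∀ x, R (S x) = 0 := fun x => by rw [← hRτ, hτS, map_zero]
  have hSR : ∀ x, S (R x) = 0 := fun x => by rw [← hτR, hSτ]
  have hSu : ∀ x, S (u x) = u x - u (τ x) - u (S x) := fun x => hext _ _ fun y => by
    simp only [map_sub, LinearMap.sub_apply, hS, hu, hbτ, hRu, huτ]
    abel
  refine ⟨R + LinearMap.id - τ - S, fun x => ?_, fun x => ?_, fun x y => ?_⟩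
  · simp only [LinearMap.sub_apply, LinearMap.add_apply, LinearMap.id_apply, map_sub, map_add,
      hRR, hRτ, hRS, hττ, hτR, hτS, hSR, hSS, hSτ]
    abel
  · simp only [LinearMap.sub_apply, LinearMap.add_apply, LinearMap.id_apply, map_sub, map_add,
      hRu, hSu, huτ]
    abel
  · simp only [LinearMap.sub_apply, LinearMap.add_apply, LinearMap.id_apply, map_sub, map_add,
      hS, hS', hbτ]
    abel

lemma isBAlternating_apply_eq (hb : b.IsAlt) (hu : IsBAlternating b u) (x y : V) :
    b (u x) y = b x (u y) := by
  have h := hu (x + y)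
  simp only [map_add, LinearMap.add_apply, hu x, hu y, add_zero, zero_add] at h
  rw [← hb.neg_eq, neg_eq_iff_add_eq_zero]
  exact h

/-- The invariant factors of a module `(⨁ i, F[X] ⧸ (p i)) ^ 2` are the `p i`, each of them
repeated twice. -/
lemma isInvariantFactor_of_equiv_prod {r : ℕ} {p : Fin r → F[X]}
    (e : Module.AEval' u ≃ₗ[F[X]]
      (∀ i, F[X] ⧸ Ideal.span {p i}) × (∀ i, F[X] ⧸ Ideal.span {p i}))
    (hmonic : ∀ i, (p i).Monic) (hpos : ∀ i, 0 < (p i).natDegree)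
    (hdvd : ∀ i j, i ≤ j → p j ∣ p i) (i : Fin r) : IsInvariantFactor u (p i) := by
  let ε : Fin r ⊕ Fin r ≃ Fin (r * 2) :=
    (Equiv.boolProdEquivSum (Fin r)).symm.trans <| (Equiv.prodComm _ _).trans <|
      ((Equiv.refl _).prodCongr finTwoEquiv.symm).trans finProdFinEquiv
  let s : Fin r ⊕ Fin r → Fin r := Sum.elim id id
  have hs : ∀ j, (s (ε.symm j) : ℕ) = j / 2 := by
    intro j
    obtain ⟨k, rfl⟩ := ε.surjective j
    rw [Equiv.symm_apply_apply]
    rcases k with k | k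
    · change (k : ℕ) = (0 + 2 * k) / 2
      omega
    · change (k : ℕ) = (1 + 2 * k) / 2
      omega
  refine ⟨r * 2, fun j => p (s (ε.symm j)), ⟨fun j => hmonic _, fun j => hpos _, ?_, ⟨?_⟩⟩,
    ε (.inl i), congrArg (fun k => p (s k)) (ε.symm_apply_apply _)⟩
  · intro j k hjk
    refine hdvd _ _ (Fin.le_def.2 ?_)
    rw [hs, hs]
    exact Nat.div_le_div_right hjk
  · exact e ≪≫ₗ
      (LinearEquiv.sumPiEquivProdPi F[X] (Fin r) (Fin r)
        fun k => F[X] ⧸ Ideal.span {p (s k)}).symm ≪≫ₗ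
      LinearEquiv.piCongrLeft' F[X] (fun k => F[X] ⧸ Ideal.span {p (s k)}) ε ≪≫ₗ
      (DirectSum.linearEquivFunOnFintype F[X] (Fin (r * 2))
        fun j => F[X] ⧸ Ideal.span {p (s (ε.symm j))}).symm

/-- If every invariant factor is even or odd, then `V` has two decompositions into Lagrangian
subspaces, given by projections `τ` and `π`: the summands are stable under `u` for the first one,
and exchanged by `u` for the second one. -/
theorem exists_lagrangian_projections [FiniteDimensional F V] (hb : b.IsAlt)
    (hnd : b.Nondegenerate)
    (hu : IsBAlternating b u)
    (h : ∀ q : F[X], IsInvariantFactor u q → IsEvenPoly q ∨ IsOddPoly q) :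
    ∃ τ π : Module.End F V,
      ((∀ x, τ (τ x) = τ x) ∧ (∀ x, τ (u x) = u (τ x)) ∧ ∀ x y, b (τ x) y = b x (y - τ y)) ∧
      ((∀ x, π (π x) = π x) ∧ (∀ x, π (u x) = u (x - π x)) ∧
        ∀ x y, b (π x) y = b x (y - π y)) := by
  let o := Module.AEval'.of u
  have hoX : ∀ x, o (u x) = (X : F[X]) • o x := fun x => (Module.AEval'.X_smul_of u x).symm
  obtain ⟨r, p, e, hmonic, hpos, hdvd, h₁, h₂⟩ := exists_lagrangian_decomposition
    (Module.finrank F (Module.AEval' u)) (Module.AEval' u)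
    (LinearMap.BilinForm.congr o b) rfl (fun x => hb _) (hnd.congr o) (fun x => by
      rw [LinearMap.BilinForm.congr_apply, Module.AEval'.of_symm_X_smul]
      exact hu _)
  choose ρ hρρ hρX using fun i =>
    exists_proj_quotient (h _ (isInvariantFactor_of_equiv_prod e hmonic hpos hdvd i))
  let E := o ≪≫ₗ e.restrictScalars F
  have hE : ∀ x, E (u x) = (X : F[X]) • E x := fun x => by
    change e (o (u x)) = (X : F[X]) • e (o x)
    rw [hoX, map_smul]
  have hEs : ∀ v, E.symm ((X : F[X]) • v) = u (E.symm v) := fun v => by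
    rw [LinearEquiv.symm_apply_eq, hE, LinearEquiv.apply_symm_apply]
  have hb₁ : ∀ f f', b (E.symm (f, 0)) (E.symm (f', 0)) = 0 := h₁
  have hb₂ : ∀ f f', b (E.symm (0, f)) (E.symm (0, f')) = 0 := h₂
  let τ : Module.End F V := E.symm.toLinearMap ∘ₗ LinearMap.inl F _ _ ∘ₗ LinearMap.fst F _ _ ∘ₗ
    E.toLinearMap
  let ρ' := LinearMap.pi fun i => ρ i ∘ₗ LinearMap.proj (R := F)
    (φ := fun i => F[X] ⧸ Ideal.span {p i}) i
  let R : Module.End F V := E.symm.toLinearMap ∘ₗ LinearMap.inl F _ _ ∘ₗ ρ' ∘ₗ LinearMap.fst F _ _ ∘ₗ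
    E.toLinearMap
  have hτ : ∀ x, τ x = E.symm ((E x).1, 0) := fun x => rfl
  have hR : ∀ x, R x = E.symm (ρ' (E x).1, 0) := fun x => rfl
  have hττ : ∀ x, τ (τ x) = τ x := fun x => by rw [hτ, hτ, LinearEquiv.apply_symm_apply]
  have hτu : ∀ x, τ (u x) = u (τ x) := fun x => by
    rw [hτ, hτ, hE, ← hEs]
    exact congrArg E.symm (Prod.ext rfl (smul_zero _).symm)
  have hbτ : ∀ x y, b (τ x) y = b x (y - τ y) := fun x y => by
    have h1 : ∀ x, x - τ x = E.symm (0, (E x).2) := fun x => by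
      rw [hτ, eq_comm, LinearEquiv.symm_apply_eq, map_sub, LinearEquiv.apply_symm_apply]
      ext <;> simp
    have h2 : b (τ x) (τ y) = 0 := hb₁ _ _
    have h3 : b (x - τ x) (y - τ y) = 0 := by
      rw [h1, h1]
      exact hb₂ _ _
    simp only [map_sub, LinearMap.sub_apply, h2] at h3 ⊢
    linear_combination -h3
  obtain ⟨π, hπ⟩ := exists_lagrangian_grading hb hnd (isBAlternating_apply_eq hb hu)
    (R := R) hττ hbτ
    (fun x => by rw [hτ, hR, LinearEquiv.apply_symm_apply])
    (fun x => by rw [hR, hτ, LinearEquiv.apply_symm_apply, ← hR])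
    (fun x => by
      rw [hR, hR, LinearEquiv.apply_symm_apply]
      congr 2
      ext1 i
      exact hρρ i _)
    (fun x => by
      rw [hR, hR, hτ, ← hEs, ← hEs, ← map_sub, hE]
      congr 1
      ext1
      · ext1 i
        exact (hρX i _).trans (smul_sub _ _ _)
      · simp) hτu
  exact ⟨τ, π, ⟨hττ, hτu, hbτ⟩, hπ⟩

/-- The involution `2τ - 1` attached to a decomposition into Lagrangian subspaces reverses the sign
of the form. -/
lemma exists_symmetry {τ : Module.End F V} (hττ : ∀ x, τ (τ x) = τ x)
    (hbτ : ∀ x y, b (τ x) y = b x (y - τ y)) :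
    ∃ φ : V ≃ₗ[F] V, (∀ x, φ x = (2 : F) • τ x - x) ∧ ∀ x y, b (φ x) (φ y) = -b x y := by
  refine ⟨LinearEquiv.ofInvolutive ((2 : F) • τ - LinearMap.id) fun x => ?_, fun x => rfl,
    fun x y => ?_⟩
  · simp only [LinearMap.sub_apply, LinearMap.smul_apply, LinearMap.id_apply, map_sub, map_smul,
      hττ]
    module
  · change b ((2 : F) • τ x - x) ((2 : F) • τ y - y) = _
    simp only [map_sub, map_smul, LinearMap.sub_apply, LinearMap.smul_apply, hbτ, smul_eq_mul,
      hττ]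
    ring

end Grading

theorem mainTheorem6 {F V : Type*} [Field F] [AddCommGroup V] [Module F V]
    [FiniteDimensional F V]
    (b : LinearMap.BilinForm F V) (hb_alt : b.IsAlt) (hb_nondeg : b.Nondegenerate)
    (u : Module.End F V) (hu : IsBAlternating b u) :
    [ (∃ a₁ a₂ : Module.End F V, IsBAlternating b a₁ ∧ IsBAlternating b a₂ ∧
        a₁ ^ 2 = 0 ∧ a₂ ^ 2 = 0 ∧ u = a₁ + a₂),
      (∃ a₁ a₂ : Module.End F V, a₁ ^ 2 = 0 ∧ a₂ ^ 2 = 0 ∧ u = a₁ + a₂),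
      (∀ q : Polynomial F, IsInvariantFactor u q → IsEvenPoly q ∨ IsOddPoly q) ].TFAE ∧
    (ringChar F ≠ 2 →
      [ (∃ a₁ a₂ : Module.End F V, IsBAlternating b a₁ ∧ IsBAlternating b a₂ ∧
          a₁ ^ 2 = 0 ∧ a₂ ^ 2 = 0 ∧ u = a₁ + a₂),
        (∃ a₁ a₂ : Module.End F V, a₁ ^ 2 = 0 ∧ a₂ ^ 2 = 0 ∧ u = a₁ + a₂),
        (∀ q : Polynomial F, IsInvariantFactor u q → IsEvenPoly q ∨ IsOddPoly q),
        AreSimilar u (-u),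
        (∃ φ ∈ isometryGroup b, φ.conj u = -u) ].TFAE) := by
  have h12 : (∃ a₁ a₂ : Module.End F V, IsBAlternating b a₁ ∧ IsBAlternating b a₂ ∧
      a₁ ^ 2 = 0 ∧ a₂ ^ 2 = 0 ∧ u = a₁ + a₂) →
      ∃ a₁ a₂ : Module.End F V, a₁ ^ 2 = 0 ∧ a₂ ^ 2 = 0 ∧ u = a₁ + a₂ :=
    fun ⟨a₁, a₂, _, _, h⟩ => ⟨a₁, a₂, h⟩
  have h23 : (∃ a₁ a₂ : Module.End F V, a₁ ^ 2 = 0 ∧ a₂ ^ 2 = 0 ∧ u = a₁ + a₂) →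
      ∀ q : F[X], IsInvariantFactor u q → IsEvenPoly q ∨ IsOddPoly q := by
    rintro ⟨a₁, a₂, h₁, h₂, h⟩ _ ⟨r, p, hp, i, rfl⟩
    obtain ⟨E⟩ := hp.equiv
    let o := Module.AEval'.of u
    have hsq : ∀ a : Module.End F V, a ^ 2 = 0 → o.conj a ^ 2 = 0 := fun a ha => by
      rw [sq, Module.End.mul_eq_comp, ← LinearEquiv.conj_comp, ← Module.End.mul_eq_comp, ← sq, ha,
        map_zero]
    refine isEvenPoly_or_isOddPoly_of_sq_eq_zero hp.dvd hp.monic E (hsq a₁ h₁) (hsq a₂ h₂)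
      (fun x => ?_) i
    rw [LinearEquiv.conj_apply_apply, LinearEquiv.conj_apply_apply, ← map_add,
      ← LinearMap.add_apply, ← h, ← Module.AEval'.X_smul_of]
    rfl
  have h31 : (∀ q : F[X], IsInvariantFactor u q → IsEvenPoly q ∨ IsOddPoly q) →
      ∃ a₁ a₂ : Module.End F V, IsBAlternating b a₁ ∧ IsBAlternating b a₂ ∧
        a₁ ^ 2 = 0 ∧ a₂ ^ 2 = 0 ∧ u = a₁ + a₂ := by
    intro h
    obtain ⟨-, π, -, hππ, hπu, hbπ⟩ := exists_lagrangian_projections hb_alt hb_nondeg hu h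
    have h₁ : IsBAlternating b (u * π) := by
      intro x
      have h2 : u (π x) - π (u (π x)) = u (π x) := by rw [hπu, hππ, sub_self, map_zero, sub_zero]
      change b x (u (π x)) = 0
      rw [← h2, ← hbπ]
      exact hu _
    refine ⟨u * π, u - u * π, h₁, fun x => ?_, ?_, ?_, by abel⟩
    · rw [LinearMap.sub_apply, map_sub, hu, h₁, sub_zero]
    · ext x
      simp [sq, hπu, hππ]
    · ext x
      simp [sq, hπu, hππ]
  have h54 : (∃ φ ∈ isometryGroup b, φ.conj u = -u) → AreSimilar u (-u) :=
    fun ⟨φ, _, h⟩ => ⟨φ, h⟩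
  have h35 : (∀ q : F[X], IsInvariantFactor u q → IsEvenPoly q ∨ IsOddPoly q) →
      ∃ φ ∈ isometryGroup b, φ.conj u = -u := by
    intro h
    obtain ⟨τ, π, ⟨hττ, hτu, hbτ⟩, hππ, hπu, hbπ⟩ :=
      exists_lagrangian_projections hb_alt hb_nondeg hu h
    obtain ⟨φ, hφ, hbφ⟩ := exists_symmetry hττ hbτ
    obtain ⟨ψ, hψ, hbψ⟩ := exists_symmetry hππ hbπ
    -- Both involutions change the sign of `b`, hence their product is an isometry.
    refine ⟨φ ≪≫ₗ ψ, fun x y => ?_, ?_⟩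
    · rw [LinearEquiv.trans_apply, LinearEquiv.trans_apply, hbψ, hbφ, neg_neg]
    -- `φ` commutes with `u`, and `ψ` anticommutes with it.
    · have hφu : ∀ x, φ (u x) = u (φ x) := fun x => by
        rw [hφ, hφ, hτu, map_sub, map_smul]
      have hψu : ∀ x, ψ (u x) = -u (ψ x) := fun x => by
        rw [hψ, hψ, hπu, map_sub, map_sub, map_smul]
        module
      ext x
      rw [LinearEquiv.conj_apply_apply, LinearEquiv.trans_apply, hφu, hψu,
        ← LinearEquiv.trans_apply, LinearEquiv.apply_symm_apply, LinearMap.neg_apply]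
  have h43 : ringChar F ≠ 2 → AreSimilar u (-u) →
      ∀ q : F[X], IsInvariantFactor u q → IsEvenPoly q ∨ IsOddPoly q := by
    rintro h2 ⟨φ, h⟩ _ ⟨r, p, hp, i, rfl⟩
    obtain ⟨E⟩ := hp.equiv
    let o := Module.AEval'.of u
    refine isEvenPoly_or_isOddPoly_of_similar_neg h2 hp.dvd E (o.symm ≪≫ₗ φ ≪≫ₗ o)
      (fun x => ?_) i
    have h' : φ (u (o.symm x)) = -u (φ (o.symm x)) := by
      rw [← LinearMap.neg_apply, ← h, LinearEquiv.conj_apply_apply, LinearEquiv.symm_apply_apply]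
    simp only [LinearEquiv.trans_apply]
    rw [Module.AEval'.of_symm_X_smul, Module.AEval'.X_smul_of, ← map_neg, ← h']
  refine ⟨?_, fun h2 => ?_⟩
  · tfae_have 1 → 2 := h12
    tfae_have 2 → 3 := h23
    tfae_have 3 → 1 := h31
    tfae_finish
  · tfae_have 1 → 2 := h12
    tfae_have 2 → 3 := h23
    tfae_have 3 → 1 := h31
    tfae_have 3 → 5 := h35
    tfae_have 5 → 4 := h54
    tfae_have 4 → 3 := h43 h2
    tfae_finish
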